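/- Let $\mathcal G$ be a directed acyclic graph on a finite vertex set $\mathcal V\sqcup\mathcal L$ of visible and latent vertices which is exo-simplicial: no latent vertex has a parent, and $\ell\mapsto \mathrm{ch}(\ell)$ is a bijection from $\mathcal L$ onto the set of facets (maximal faces) of an abstract simplicial complex over $\mathcal V$ (in which every singleton $\{v\}$, $v\in\mathcal V$, is a face). Let every visible $v$ have a finite outcome set $\Omega_v$ and every latent $\ell$ an arbitrary, possibly infinite, measurable outcome space $\Omega_\ell$. A causal model on $\mathcal G$ with these outcome spaces consists of a probability measure $\mathrm P_\ell$ on $\Omega_\ell$ for every $\ell\in\mathcal L$ and, for every $v\in\mathcal V$, a conditional distribution $\mathrm P_{v|\mathrm{pa}(v)}(x_v\mid x_{\mathrm{vpa}(v)},\lambda_{\mathrm{lpa}(v)})$ of $x_v$ given the values of the visible parents $\mathrm{vpa}(v)$ and of the latent parents $\mathrm{lpa}(v)$ of $v$, measurable in $\lambda_{\mathrm{lpa}(v)}$. It produces the distribution $$\mathrm P_{\mathcal V}(x_{\mathcal V})=\int \prod_{v\in\mathcal V}\mathrm P_{v|\mathrm{pa}(v)}(x_v\mid x_{\mathrm{vpa}(v)},\lambda_{\mathrm{lpa}(v)})\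 \mathrm d\Big(\bigotimes_{\ell\in\mathcal L}\mathrm P_\ell\Big)(\lambda)\qquad (x_{\mathcal V}\in\Omega_{\mathcal V}=\textstyle\prod_{v}\Omega_v).$$ For a latent vertex $\xi$ let its district $D_\xi\subseteq\mathcal V$ be the set of visible vertices joined to $\xi$ by an undirected path with alternating visible and latent vertices. Let $\bar D_\xi$ be the set of visible parents of vertices of $D_\xi$ that do not lie in $D_\xi$, and let $B_\xi$ be the set of vertices of $D_\xi$ that are not descendants of $\xi$. For $S,T\subseteq\mathcal V$ let $\mathbb P_{S|T}\subseteq\mathbb R^{\Omega_T\times\Omega_S}$ be the set of all conditional distributions $\mathrm P_{S|T}(x_S\mid x_T)$ of the variables in $S$ given those in $T$, and let $\mathrm{aff}(X)$ denote the affine dimension of a set $X$, i.e. the dimension of its affine span. Theorem. For every causal model on $\mathcal G$ as above, producing $\mathrm P_{\mathcal V}$, there is a causal model on the same $\mathcal G$, with the same visible outcome sets $\Omega_v$ and with finite latent outcome sets of cardinalities $k_\ell$ ($\ell\in\mathcal L$), which also produces $\mathrm P_{\mathcal V}$ and satisfies, for all $\xi\in\mathcal L$ simultaneously, $$k_\xi\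 \le\ \max\bigl\{1,\ \mathrm{aff}(\mathbb P_{D_\xi|\bar D_\xi})-\mathrm{aff}(\mathbb P_{B_\xi|\bar D_\xi})\bigr\}.$$ -/

import Mathlib

open MeasureTheory

noncomputable section

namespace LatentCausal

/-- A causal structure: a directed acyclic graph whose vertices are partitioned into visible
vertices (`Sum.inl v`) and latent vertices (`Sum.inr ℓ`); `Adj q u` is the edge `q → u`. -/
structure CausalStructure (V L : Type*) extends Digraph (V ⊕ L) where
  acyclic : ∀ q, ¬ Relation.TransGen Adj q q

namespace CausalStructure

variable {V L : Type*} (G : CausalStructure V L)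

/-- The visible parents of a visible vertex. -/
def visParents (v : V) : Set V := {u | G.Adj (Sum.inl u) (Sum.inl v)}

/-- The latent parents of a visible vertex. -/
def latParents (v : V) : Set L := {ℓ | G.Adj (Sum.inr ℓ) (Sum.inl v)}

open Classical in
/-- The visible children of a latent vertex. -/
def children [Fintype V] (ℓ : L) : Finset V :=
  Finset.univ.filter fun v => G.Adj (Sum.inr ℓ) (Sum.inl v)

/-- Exo-simplicial: latent vertices have no parents, and `ℓ ↦ ch(ℓ)` is a bijection from the
latent vertices onto the facets (maximal faces) of an abstract simplicial complex over the visible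
vertices (all singletons of visible vertices being faces). -/
def IsExoSimplicial [Fintype V] : Prop :=
  (∀ (q : V ⊕ L) (ℓ : L), ¬ G.Adj q (Sum.inr ℓ)) ∧
    ∃ K : AbstractSimplicialComplex V,
      Set.BijOn G.children Set.univ {s | Maximal (fun t => t ∈ K.faces) s}

/-- The undirected graph of those edges that join a visible and a latent vertex; its paths are the
undirected paths with alternating visible and latent vertices. -/
def alternatingGraph : SimpleGraph (V ⊕ L) where
  Adj q u := q.isLeft ≠ u.isLeft ∧ (G.Adj q u ∨ G.Adj u q)
  symm := ⟨fun _ _ h => ⟨h.1.symm, h.2.symm⟩⟩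
  loopless := ⟨fun _ h => h.1 rfl⟩

/-- The district `D` of a latent vertex `ξ`: the visible vertices joined to `ξ` by an alternating
undirected path. -/
def district (ξ : L) : Set V := {v | G.alternatingGraph.Reachable (Sum.inl v) (Sum.inr ξ)}

/-- `D̄`: the visible parents of vertices of `D` that do not lie in `D`. -/
def districtParents (ξ : L) : Set V :=
  {u | ∃ v ∈ G.district ξ, u ∈ G.visParents v} \ G.district ξ

/-- `A`: the vertices of the district of `ξ` that are descendants of `ξ`. -/
def districtDesc (ξ : L) : Set V :=
  {v | v ∈ G.district ξ ∧ Relation.TransGen G.Adj (Sum.inr ξ) (Sum.inl v)}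

/-- `B = D \ A`: the vertices of the district of `ξ` that are not descendants of `ξ`. -/
def districtNonDesc (ξ : L) : Set V := G.district ξ \ G.districtDesc ξ

end CausalStructure

/-- Causal parameters for a causal structure with exogenous latent vertices, with finite visible
outcome sets `Ω v` and arbitrary measurable latent outcome spaces `Λ ℓ`: a probability measure
`P_ℓ` for every latent vertex, and for every visible vertex `v` a conditional distribution
`P_{v|pa(v)}(x_v | x_{vpa(v)}, λ_{lpa(v)}) = response v x_{vpa(v)} λ_{lpa(v)} x_v`. -/
structure CausalModel {V L : Type*} (G : CausalStructure V L)
    (Ω : V → Type*) [∀ v, Fintype (Ω v)] (Λ : L → Type*) [∀ ℓ, MeasurableSpace (Λ ℓ)] where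
  latent : ∀ ℓ, ProbabilityMeasure (Λ ℓ)
  response : ∀ v, (∀ u : G.visParents v, Ω u) → (∀ ℓ : G.latParents v, Λ ℓ) → Ω v → ℝ
  response_mem : ∀ v y l, response v y l ∈ stdSimplex ℝ (Ω v)
  response_measurable : ∀ v y a, Measurable fun l => response v y l a

/-- The distribution of the visible variables produced by a causal model:
`P_V(x) = ∫ ∏_v P_{v|pa(v)}(x_v | x_{vpa(v)}, λ_{lpa(v)}) d(⊗_ℓ P_ℓ)(λ)`. -/
def CausalModel.observed {V L : Type*} [Fintype V] [Fintype L] {G : CausalStructure V L}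
    {Ω : V → Type*} [∀ v, Fintype (Ω v)] {Λ : L → Type*} [∀ ℓ, MeasurableSpace (Λ ℓ)]
    (M : CausalModel G Ω Λ) (x : ∀ v, Ω v) : ℝ :=
  ∫ l : (∀ ℓ, Λ ℓ), ∏ v, M.response v (fun u => x u) (fun ℓ => l ℓ) (x v)
    ∂(Measure.pi fun ℓ => (M.latent ℓ : Measure (Λ ℓ)))

open Classical in
/-- The set of all conditional distributions `P_{S|T}(x_S | x_T)` of the variables in `S` given
those in `T`. -/
def condDistributions {V : Type*} [Fintype V] (Ω : V → Type*) [∀ v, Fintype (Ω v)]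
    (S T : Set V) : Set ((∀ t : T, Ω t) → (∀ s : S, Ω s) → ℝ) :=
  {p | ∀ y, p y ∈ stdSimplex ℝ (∀ s : S, Ω s)}

/-- The affine dimension of a set: the dimension of its affine span. -/
def affineDimension {E : Type*} [AddCommGroup E] [Module ℝ E] (s : Set E) : ℕ :=
  Module.finrank ℝ (vectorSpan ℝ s)

end LatentCausal

end

/-! The latent variables are reduced one at a time. The joint distribution factorizes into the
conditional distribution of the district of `ξ` and a factor that does not involve `ξ`
(`visibleDist_univ`). Averaging over `ξ` therefore mixes points of the set `S` of district
distributions obtained when the children of `ξ` use kernels that ignore `ξ` and all other kernels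
are kept. Conversely, a mixture of `k` points of `S` is realized by a `ξ` with `k` outcomes, each
selecting one family of kernels (`visibleDist_select`). So the question is how many points of `S`
are needed.

Two facts give the bound. Every point of `S` has the same marginal on the non-descendants of `ξ` in
the district, so rank-nullity for marginalization bounds the affine dimension of `S` by the
difference of the two dimensions (`finrank_vectorSpan_add_le`). And `S` is connected, being a
continuous image of a convex set, so the Fenchel–Bunt theorem saves one point over Carathéodory
(`isCombination_of_isPreconnected`).

The other latents keep their weights and the bound depends only on `G` and `Ω`, so the reductions
can be iterated. Infinite latent spaces are first made finite, one by one: a mean over one latent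
lies in the convex hull of the values, even if the hull is not closed (`integral_mem_of_convex`),
and Carathéodory yields a finitely supported replacement (`exists_latentMean_eq`). -/

namespace LatentCausal

/-! ### Means in convex sets, Carathéodory and Fenchel–Bunt. -/

section Convexity

/-- In finite dimension, the mean of an integrable function with values in a convex set lies in
that set, closed or not. -/
theorem integral_mem_of_convex {α : Type*} [MeasurableSpace α] (μ : Measure α)
    [IsProbabilityMeasure μ] (n : ℕ) :
    ∀ {E : Type*} [NormedAddCommGroup E] [NormedSpace ℝ E] [FiniteDimensional ℝ E] (s : Set E)
      (g : α → E), Module.finrank ℝ E = n → Convex ℝ s → Integrable g μ →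
      (∀ᵐ a ∂μ, g a ∈ s) → ∫ a, g a ∂μ ∈ s := by
  induction n using Nat.strong_induction_on with
  | _ n ih =>
  intro E _ _ _ s g hn hs hg hgs
  by_contra hm
  set m := ∫ a, g a ∂μ with hmdef
  have hmean : ∀ f : E →L[ℝ] ℝ, ∫ a, f (g a) ∂μ = f m := fun f => f.integral_comp_comm hg
  -- A mean outside `s` forces `g` into a hyperplane through `m`, which lowers the dimension. If `s`
  -- has interior, a supporting functional gives a nonnegative function of mean zero; otherwise `s`
  -- itself lies in a proper affine subspace.
  obtain ⟨f, hf0, hf⟩ : ∃ f : E →L[ℝ] ℝ, f ≠ 0 ∧ ∀ᵐ a ∂μ, f (g a) = f m := by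
    by_cases hint : (interior s).Nonempty
    · obtain ⟨f, hf0, hf⟩ := geometric_hahn_banach_of_nonempty_interior_point hs
        (fun h => hm (interior_subset h)) hint
      refine ⟨f, hf0, ?_⟩
      have hfi : Integrable (fun a => f m - f (g a)) μ :=
        (integrable_const _).sub (f.integrable_comp hg)
      have h0 : 0 ≤ᵐ[μ] fun a => f m - f (g a) := by
        filter_upwards [hgs] with a ha using sub_nonneg.2 (hf _ ha)
      have h1 : ∫ a, (f m - f (g a)) ∂μ = 0 := by
        rw [integral_sub (integrable_const _) (f.integrable_comp hg), hmean]; simp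
      filter_upwards [(integral_eq_zero_iff_of_nonneg_ae h0 hfi).1 h1] with a ha
      simp only [Pi.zero_apply] at ha
      linarith
    · obtain ⟨a₀, ha₀⟩ := hgs.exists
      have htop : affineSpan ℝ s ≠ ⊤ := fun h =>
        hint ((hs.interior_nonempty_iff_affineSpan_eq_top).2 h)
      have hdir : (affineSpan ℝ s).direction < ⊤ := by
        refine lt_top_iff_ne_top.2 fun h => htop ?_
        exact (AffineSubspace.direction_eq_top_iff_of_nonempty
          ⟨g a₀, subset_affineSpan ℝ s ha₀⟩).1 h
      obtain ⟨f, hf0, hf⟩ := Submodule.exists_le_ker_of_lt_top _ hdir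
      have hconst : ∀ᵐ a ∂μ, f.toContinuousLinearMap (g a) = f (g a₀) := by
        filter_upwards [hgs] with a ha
        have : g a - g a₀ ∈ (affineSpan ℝ s).direction :=
          AffineSubspace.vsub_mem_direction (subset_affineSpan ℝ s ha) (subset_affineSpan ℝ s ha₀)
        have h := hf this
        rw [LinearMap.mem_ker, map_sub, sub_eq_zero] at h
        exact h
      refine ⟨f.toContinuousLinearMap, fun h => hf0 (by ext x; exact DFunLike.congr_fun h x), ?_⟩
      have hm' : f.toContinuousLinearMap m = f (g a₀) := by
        rw [← hmean, integral_congr_ae hconst]; simp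
      filter_upwards [hconst] with a ha
      rw [ha, hm']
  let K := LinearMap.ker (f : E →ₗ[ℝ] ℝ)
  -- `g a - m` lies in `K` only almost everywhere; the retraction `π` makes the integrand `K`-valued
  -- everywhere.
  obtain ⟨π, hπ⟩ := K.subtype.exists_leftInverse_of_injective K.ker_subtype
  have hπK : ∀ x : E, x ∈ K → ((π x : K) : E) = x := fun x hx =>
    congrArg Subtype.val (DFunLike.congr_fun hπ (⟨x, hx⟩ : K))
  have hKn : Module.finrank ℝ K < n := by
    rw [← hn]
    refine Submodule.finrank_lt fun h => hf0 ?_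
    ext x
    have : x ∈ K := h ▸ Submodule.mem_top
    exact this
  have hgi : Integrable (fun a => g a - m) μ := hg.sub (integrable_const _)
  have key := ih _ hKn (E := K) {k : K | m + k ∈ s}
    (fun a => π.toContinuousLinearMap (g a - m)) rfl ?_
    (π.toContinuousLinearMap.integrable_comp hgi) ?_
  · rw [ContinuousLinearMap.integral_comp_comm _ hgi,
      integral_sub hg (integrable_const _)] at key
    simp only [integral_const, probReal_univ, one_smul, ← hmdef, sub_self, map_zero] at key
    exact hm (by simpa using key)
  · intro x hx y hy a b ha hb hab
    have := hs hx hy ha hb hab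
    have e : m + ((a • x + b • y : K) : E) = a • (m + (x : E)) + b • (m + (y : E)) := by
      rw [smul_add, smul_add, add_add_add_comm, ← add_smul, hab, one_smul]; rfl
    simpa only [Set.mem_ofPred_eq, e] using this
  · filter_upwards [hgs, hf] with a ha hfa
    have : g a - m ∈ K := by
      rw [LinearMap.mem_ker]; simp [hfa]
    change m + ((π (g a - m) : K) : E) ∈ s
    rw [hπK _ this]
    simpa using ha

variable {W : Type*}

/-- A convex combination of at most `K` points of `S`, indexed by `Fin N` with `K ≤ N`. -/
def IsCombination [AddCommGroup W] [Module ℝ W] (S : Set W) (K N : ℕ) (x : W) : Prop :=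
  ∃ (z : Fin N → W) (w : Fin N → ℝ), (∀ i, z i ∈ S) ∧ w ∈ stdSimplex ℝ (Fin N) ∧
    (∀ i : Fin N, K ≤ i → w i = 0) ∧ ∑ i, w i • z i = x

/-- Pads with weight zero. The unused slots repeat a point `z i₀` so that they stay in `S`; `i₀`
exists because the weights sum to one. -/
theorem isCombination_of_card_le [AddCommGroup W] [Module ℝ W] {S : Set W} {K N : ℕ}
    (hKN : K ≤ N) {ι : Type*} [Fintype ι] (z : ι → W) (w : ι → ℝ) (hz : ∀ i, z i ∈ S)
    (hw : w ∈ stdSimplex ℝ ι) (t : Finset ι) (ht : t.card ≤ K) (hwt : ∀ i ∉ t, w i = 0) :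
    IsCombination S K N (∑ i, w i • z i) := by
  classical
  have hsum1 : ∑ i ∈ t, w i = 1 := by
    rw [← hw.2]
    exact Finset.sum_subset (Finset.subset_univ _) fun i _ hi => hwt i hi
  have hsum2 : ∑ i ∈ t, w i • z i = ∑ i, w i • z i :=
    Finset.sum_subset (Finset.subset_univ _) fun i _ hi => by rw [hwt i hi, zero_smul]
  obtain ⟨i₀, hi₀⟩ : t.Nonempty := by
    rw [Finset.nonempty_iff_ne_empty]; rintro rfl; simp at hsum1
  let e : t ≃ Fin t.card := t.equivFin
  let c : t → Fin N := fun i => Fin.castLE (ht.trans hKN) (e i)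
  have hc : Function.Injective c := fun i j h => e.injective (Fin.castLE_injective _ h)
  let z' : Fin N → W := fun j => if h : (j : ℕ) < t.card then z (e.symm ⟨j, h⟩) else z i₀
  let w' : Fin N → ℝ := fun j => if h : (j : ℕ) < t.card then w (e.symm ⟨j, h⟩) else 0
  have hz' : ∀ i, z' (c i) = z i := fun i => by simp [z', c]
  have hw' : ∀ i, w' (c i) = w i := fun i => by simp [w', c]
  have hout : ∀ j, j ∉ Set.range c → w' j = 0 := by
    intro j hj
    by_cases h : (j : ℕ) < t.card
    · exact (hj ⟨e.symm ⟨j, h⟩, by ext; simp [c]⟩).elim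
    · simp [w', h]
  refine ⟨z', w', fun j => ?_, ⟨fun j => ?_, ?_⟩, fun j hj => ?_, ?_⟩
  · by_cases h : (j : ℕ) < t.card <;> simp only [z', h, dite_true, dite_false] <;> exact hz _
  · by_cases h : (j : ℕ) < t.card <;> simp only [w', h, dite_true, dite_false, le_refl]
    exact hw.1 _
  · rw [← hsum1, ← Finset.sum_coe_sort t]
    refine (Fintype.sum_of_injective c hc _ _ (fun j hj => hout j hj) fun i => ?_).symm
    exact (hw' i).symm
  · have : ¬ (j : ℕ) < t.card := by omega
    simp [w', this]
  · rw [← hsum2, ← Finset.sum_coe_sort t]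
    refine (Fintype.sum_of_injective c hc _ _ (fun j hj => ?_) fun i => ?_).symm
    · rw [hout j hj, zero_smul]
    · rw [hz', hw']

/-- **Carathéodory's theorem**, in indexed form. -/
theorem isCombination_of_mem_convexHull [AddCommGroup W] [Module ℝ W] [FiniteDimensional ℝ W]
    {S : Set W} {x : W} (hx : x ∈ convexHull ℝ S) {N : ℕ} (hN : Module.finrank ℝ W + 1 ≤ N) :
    IsCombination S N N x := by
  obtain ⟨ι, _, z, w, hzS, hz, hw0, hw1, rfl⟩ := eq_pos_convex_span_of_mem_convexHull hx
  refine isCombination_of_card_le le_rfl z w (fun i => hzS ⟨i, rfl⟩) ⟨fun i => (hw0 i).le, hw1⟩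
    Finset.univ ?_ (by simp)
  refine hz.card_le_finrank_succ.trans (le_trans ?_ hN)
  exact Nat.succ_le_succ (Submodule.finrank_le _)

/-- If the coordinates `b` of the points of a connected set run through all the vertices of a
simplex, then some point has two maximal ratios `b i / c i`. -/
theorem exists_two_maximal_ratios {X ι : Type*} [TopologicalSpace X] [PreconnectedSpace X]
    [Fintype ι] [DecidableEq ι] (b : X → ι → ℝ) (hb : Continuous b) (z : ι → X)
    (hz : ∀ i, b (z i) = Pi.single i 1) (c : ι → ℝ) (hc : ∀ i, 0 < c i) {i₁ i₂ : ι}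
    (hi : i₁ ≠ i₂) :
    ∃ (x : X) (i j : ι), i ≠ j ∧ b x i / c i = b x j / c j ∧ ∀ k, b x k / c k ≤ b x i / c i := by
  by_contra! hcon
  -- Without ties, the sets where the `i`-th ratio is the strict maximum are a cover by disjoint
  -- open sets, each containing its `z i`; two distinct indices contradict connectedness.
  let U : ι → Set X := fun i => {x | ∀ k, k ≠ i → b x k / c k < b x i / c i}
  have hbi : ∀ i, Continuous fun x => b x i / c i := fun i =>
    ((continuous_apply i).comp hb).div_const _
  have hU : ∀ i, IsOpen (U i) := by
    intro i
    have : U i = ⋂ k, {x | k ≠ i → b x k / c k < b x i / c i} := by ext; simp [U]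
    rw [this]
    refine isOpen_iInter_of_finite fun k => ?_
    by_cases h : k = i
    · simp [h]
    · simpa [h] using isOpen_lt (hbi k) (hbi i)
  have hdisj : ∀ i j, i ≠ j → ∀ x, x ∈ U i → x ∉ U j := fun i j hij x hx hx' =>
    lt_asymm (hx j hij.symm) (hx' i hij)
  have hcov : ∀ x, ∃ i, x ∈ U i := by
    intro x
    have : Nonempty ι := ⟨i₁⟩
    obtain ⟨i, hi⟩ := Finite.exists_max fun i => b x i / c i
    refine ⟨i, fun k hk => lt_of_le_of_ne (hi k) fun h => ?_⟩
    obtain ⟨k', hk'⟩ := hcon x i k hk.symm h.symm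
    exact absurd (hi k') (not_le.2 hk')
  have hzU : ∀ i, z i ∈ U i := by
    intro i k hk
    rw [hz]
    simp [hk, hc i]
  have hclopen : IsClopen (U i₁) := by
    refine ⟨⟨?_⟩, hU i₁⟩
    have : (U i₁)ᶜ = ⋃ i ∈ {i | i ≠ i₁}, U i := by
      ext x
      simp only [Set.mem_compl_iff, Set.mem_ofPred_eq, Set.mem_iUnion, exists_prop]
      constructor
      · intro hx
        obtain ⟨i, hi⟩ := hcov x
        exact ⟨i, fun h => hx (h ▸ hi), hi⟩
      · rintro ⟨i, hi, hx⟩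
        exact hdisj i i₁ hi x hx
    rw [this]
    exact isOpen_biUnion fun i _ => hU i
  rcases isClopen_iff.1 hclopen with h | h
  · exact (h ▸ hzU i₁ : z i₁ ∈ (∅ : Set X))
  · exact hdisj i₁ i₂ hi (z i₂) (h ▸ Set.mem_univ _) (hzU i₂)

/-- **Fenchel–Bunt theorem** for a connected set in an affine hyperplane. -/
theorem isCombination_of_isPreconnected [NormedAddCommGroup W] [NormedSpace ℝ W]
    [FiniteDimensional ℝ W] (φ : W →ₗ[ℝ] ℝ) {S : Set W} (hS : IsPreconnected S)
    (hφ : ∀ s ∈ S, φ s = 1) {x : W} (hx : x ∈ convexHull ℝ S) {N : ℕ}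
    (hN : max 1 (Module.finrank ℝ (vectorSpan ℝ S)) ≤ N) :
    IsCombination S (max 1 (Module.finrank ℝ (vectorSpan ℝ S))) N x := by
  classical
  set m := Module.finrank ℝ (vectorSpan ℝ S) with hm
  obtain ⟨ι, _, z, w, hzS, hz, hw0, hw1, rfl⟩ := eq_pos_convex_span_of_mem_convexHull hx
  have hzS' : ∀ i, z i ∈ S := fun i => hzS ⟨i, rfl⟩
  have hw : w ∈ stdSimplex ℝ ι := ⟨fun i => (hw0 i).le, hw1⟩
  have hle : vectorSpan ℝ (Set.range z) ≤ vectorSpan ℝ S := vectorSpan_mono ℝ hzS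
  have hcard : Fintype.card ι ≤ m + 1 :=
    hz.card_le_finrank_succ.trans (Nat.succ_le_succ (Submodule.finrank_mono hle))
  by_cases hsmall : Fintype.card ι ≤ max 1 m
  · exact isCombination_of_card_le hN z w hzS' hw Finset.univ hsmall (by simp)
  have hcm : Fintype.card ι = m + 1 := by omega
  have hm1 : 1 ≤ m := by omega
  -- On the hyperplane `φ = 1` affine and linear independence agree, so barycentric coordinates
  -- become the coordinates of a linear basis.
  have hlin : LinearIndependent ℝ z := by
    rw [linearIndependent_iff']
    intro s g hg
    refine affineIndependent_iff.1 hz s g ?_ hg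
    have := congrArg φ hg
    simpa [map_sum, hφ _ (hzS' _)] using this
  have hspan : ∀ s ∈ S, s ∈ Submodule.span ℝ (Set.range z) := by
    intro s hs
    obtain ⟨i₀⟩ : Nonempty ι := Fintype.card_pos_iff.1 (by omega)
    have heq : vectorSpan ℝ (Set.range z) = vectorSpan ℝ S :=
      Submodule.eq_of_le_of_finrank_eq hle (hz.finrank_vectorSpan hcm)
    have h1 : s - z i₀ ∈ vectorSpan ℝ (Set.range z) :=
      heq ▸ vsub_mem_vectorSpan ℝ hs (hzS' i₀)
    have h2 : vectorSpan ℝ (Set.range z) ≤ Submodule.span ℝ (Set.range z) := by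
      rw [vectorSpan_def, Submodule.span_le]
      rintro _ ⟨a, ha, b, hb, rfl⟩
      exact Submodule.sub_mem _ (Submodule.subset_span ha) (Submodule.subset_span hb)
    have := Submodule.add_mem _ (h2 h1) (Submodule.subset_span (Set.mem_range_self i₀))
    simpa using this
  let B := Module.Basis.span hlin
  let b : S → ι → ℝ := fun s i => B.repr ⟨s, hspan s s.2⟩ i
  have hb : Continuous b := by
    refine continuous_pi fun i => ?_
    exact (LinearMap.continuous_of_finiteDimensional (B.coord i)).comp
      (continuous_subtype_val.subtype_mk _)
  have hbz : ∀ i, b ⟨z i, hzS' i⟩ = Pi.single i 1 := by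
    intro i
    have : (⟨z i, hspan _ (hzS' i)⟩ : Submodule.span ℝ (Set.range z)) = B i :=
      (Module.Basis.span_apply hlin i).symm
    ext k
    simp only [b, this, Module.Basis.repr_self]
    rw [Finsupp.single_apply, Pi.single_apply]
    simp [eq_comm]
  have hsumb : ∀ s : S, ∑ i, b s i • z i = s := by
    intro s
    have := congrArg Subtype.val (B.sum_repr ⟨s, hspan s s.2⟩)
    simpa [B, Module.Basis.span_apply, b] using this
  have hsumb1 : ∀ s : S, ∑ i, b s i = 1 := by
    intro s
    have := congrArg φ (hsumb s)
    simpa [map_sum, hφ _ (hzS' _), hφ _ s.2] using this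
  have : PreconnectedSpace S := isPreconnected_iff_preconnectedSpace.1 hS
  obtain ⟨i₁, i₂, h12⟩ := Fintype.exists_pair_of_one_lt_card (show 1 < Fintype.card ι by omega)
  obtain ⟨s, i, j, hij, hr, hmax⟩ := exists_two_maximal_ratios b hb (fun i => ⟨z i, hzS' i⟩)
    hbz w hw0 h12
  set M := b s i / w i with hM
  have hMpos : 0 < M := by
    by_contra hneg
    have : ∑ k, b s k ≤ 0 := Finset.sum_nonpos fun k _ => by
      have h := (hmax k).trans (not_lt.1 hneg)
      rwa [div_le_iff₀ (hw0 k), zero_mul] at h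
    rw [hsumb1] at this
    linarith
  -- Split off `s` with weight `1 / M`, the largest that keeps the other weights nonnegative. The
  -- tie kills two vertices, `i` and `j`, while only `s` is added (in slot `i`): `m` points remain
  -- out of `m + 1`.
  let w₁ : ι → ℝ := fun k => w k - b s k / M
  have hw1nn : ∀ k, 0 ≤ w₁ k := fun k => by
    have h := hmax k
    rw [div_le_iff₀ (hw0 k)] at h
    have : b s k / M ≤ w k := by rw [div_le_iff₀ hMpos]; linarith
    simp only [w₁]; linarith
  have hwi : w₁ i = 0 := by
    have : b s i = M * w i := by rw [hM, div_mul_cancel₀ _ (hw0 i).ne']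
    simp only [w₁, this]
    rw [mul_div_cancel_left₀ _ hMpos.ne', sub_self]
  have hwj : w₁ j = 0 := by
    have : b s j = M * w j := by rw [hr, div_mul_cancel₀ _ (hw0 j).ne']
    simp only [w₁, this]
    rw [mul_div_cancel_left₀ _ hMpos.ne', sub_self]
  have hrep : ∑ k, Function.update w₁ i (1 / M) k • Function.update z i (s : W) k =
      ∑ k, w k • z k := by
    have e1 : ∀ k, Function.update w₁ i (1 / M) k • Function.update z i (s : W) k =
        w₁ k • z k + if k = i then (1 / M) • (s : W) else 0 := by
      intro k
      by_cases hk : k = i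
      · subst hk; simp [hwi]
      · simp [hk]
    rw [Finset.sum_congr rfl fun k _ => e1 k, Finset.sum_add_distrib, Finset.sum_ite_eq']
    simp only [Finset.mem_univ, if_true, w₁, sub_smul, Finset.sum_sub_distrib]
    rw [← hsumb s, Finset.smul_sum]
    simp only [smul_smul]
    rw [sub_add_eq_add_sub, sub_eq_iff_eq_add]
    congr 1
    refine Finset.sum_congr rfl fun k _ => ?_
    congr 1; ring
  rw [← hrep]
  refine isCombination_of_card_le hN _ _ (fun k => ?_) ⟨fun k => ?_, ?_⟩ (Finset.univ.erase j) ?_ ?_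
  · by_cases hk : k = i
    · subst hk; simp
    · simpa [hk] using hzS' k
  · by_cases hk : k = i
    · subst hk; simpa using hMpos.le
    · simpa [hk] using hw1nn k
  · have h := congrArg φ hrep
    have e : ∀ k, φ (Function.update z i (s : W) k) = 1 := by
      intro k
      by_cases hk : k = i
      · subst hk; simpa using hφ _ s.2
      · simpa [hk] using hφ _ (hzS' k)
    simpa [map_sum, e, hφ _ (hzS' _), hw1] using h
  · rw [Finset.card_erase_of_mem (Finset.mem_univ _), Finset.card_univ]; omega
  · intro k hk
    have : k = j := by simpa using hk
    subst this
    simp [hij.symm, hwj]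

end Convexity

/-- `R` places descendants below ancestors; a minimal element of `T` has no descendant in `T`. -/
theorem CausalStructure.exists_sink {V L : Type*} [Finite V] (G : CausalStructure V L)
    {T : Finset V} (hT : T.Nonempty) :
    ∃ v ∈ T, ∀ u ∈ T, v ∉ G.visParents u := by
  let R : V → V → Prop := fun u v => Relation.TransGen G.Adj (Sum.inl v) (Sum.inl u)
  have : IsTrans V R := ⟨fun _ _ _ h h' => h'.trans h⟩
  have : Std.Irrefl R := ⟨fun v => G.acyclic (Sum.inl v)⟩
  obtain ⟨v, hv, hmin⟩ := (Finite.wellFounded_of_trans_of_irrefl R).has_min (T : Set V) hT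
  exact ⟨v, hv, fun u hu h => hmin u hu (Relation.TransGen.single h)⟩

/-! ### Independent latent variables with finitely many outcomes. -/

section FiniteLatents

open Classical

variable {V L : Type*} [Fintype V] [Fintype L] {N : ℕ}

/-- The mean of `f` under independent latent variables with outcomes in `Fin N` and weights `p`. -/
noncomputable def latentMean (p : L → Fin N → ℝ) (f : (L → Fin N) → ℝ) : ℝ :=
  ∑ l, (∏ ℓ, p ℓ (l ℓ)) * f l

/-- Fubini in the coordinate `ξ`. The weights `p ξ` on the right belong to a dummy coordinate that
is overwritten by `j`. -/
theorem latentMean_update {p : L → Fin N → ℝ} (hp : ∀ ℓ, ∑ i, p ℓ i = 1) (ξ : L) (w : Fin N → ℝ)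
    (f : (L → Fin N) → ℝ) :
    latentMean (Function.update p ξ w) f =
      ∑ j, w j * latentMean p fun l => f (Function.update l ξ j) := by
  simp only [latentMean, Finset.mul_sum]
  have key : ∀ (q : L → Fin N → ℝ) (l : L → Fin N),
      ∏ ℓ, q ℓ (l ℓ) = q ξ (l ξ) * ∏ ℓ ∈ Finset.univ.erase ξ, q ℓ (l ℓ) := fun q l =>
    (Finset.mul_prod_erase _ _ (Finset.mem_univ ξ)).symm
  have hrest : ∀ (q : L → Fin N → ℝ) (w : Fin N → ℝ) (l : L → Fin N) (j : Fin N),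
      ∏ ℓ ∈ Finset.univ.erase ξ, Function.update q ξ w ℓ (Function.update l ξ j ℓ) =
        ∏ ℓ ∈ Finset.univ.erase ξ, q ℓ (l ℓ) := fun q w l j =>
    Finset.prod_congr rfl fun ℓ hℓ => by
      rw [Function.update_of_ne (Finset.ne_of_mem_erase hℓ),
        Function.update_of_ne (Finset.ne_of_mem_erase hℓ)]

  have hl : ∀ l : L → Fin N, (∏ ℓ, Function.update p ξ w ℓ (l ℓ)) * f l =
      ∑ j, p ξ j * (w (l ξ) * (∏ ℓ ∈ Finset.univ.erase ξ, p ℓ (l ℓ)) * f l) := by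
    intro l
    have h := hrest p w l (l ξ)
    rw [Function.update_eq_self] at h
    rw [← Finset.sum_mul, hp, one_mul, key, h, Function.update_self]
  rw [Finset.sum_congr rfl fun l _ => hl l, Finset.sum_comm, ← Finset.sum_product',
    ← Finset.sum_product']
  -- Both sides are now sums over pairs `(j, l)`; the involution exchanges `j` with `l ξ`.
  refine Finset.sum_nbij' (fun q => (q.2 ξ, Function.update q.2 ξ q.1))
    (fun q => (q.2 ξ, Function.update q.2 ξ q.1)) (by simp) (by simp) (by simp) (by simp) ?_
  rintro ⟨j, l⟩ -
  have h := hrest p (p ξ) l j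
  rw [Function.update_eq_self] at h
  simp only [Function.update_idem, Function.update_eq_self]
  rw [key, h, Function.update_self]
  ring

theorem latentMean_const {p : L → Fin N → ℝ} (hp : ∀ ℓ, ∑ i, p ℓ i = 1) (c : ℝ) :
    latentMean p (fun _ => c) = c := by
  rw [latentMean, ← Finset.sum_mul, ← Fintype.piFinset_univ, ← Finset.prod_univ_sum]
  simp [hp]

/-- Functions of disjoint sets of latent variables are uncorrelated. -/
theorem latentMean_mul {p : L → Fin N → ℝ} (hp : ∀ ℓ, ∑ i, p ℓ i = 1) (T : Set L)
    {a b : (L → Fin N) → ℝ} (ha : DependsOn a T) (hb : DependsOn b Tᶜ) :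
    latentMean p (fun l => a l * b l) = latentMean p a * latentMean p b := by
  have h1 : latentMean p (fun l => a l * b l) =
      ∑ l, ∑ l' : L → Fin N, ((∏ ℓ, p ℓ (l ℓ)) * (a l * b l)) * (∏ ℓ, p ℓ (l' ℓ)) := by
    have := latentMean_const hp 1
    simp only [latentMean, mul_one] at this
    simp only [← Finset.mul_sum, this, mul_one, latentMean]
  rw [h1, latentMean, latentMean, Finset.sum_mul_sum, ← Finset.sum_product',
    ← Finset.sum_product']
  have hmix : ∀ l l' : L → Fin N, T.piecewise (T.piecewise l l') (T.piecewise l' l) = l := by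
    intro l l'
    ext ℓ
    by_cases h : ℓ ∈ T <;> simp [h]
  -- With an independent copy `l'` of `l`, exchanging the coordinates outside `T` preserves the
  -- joint weight and moves the argument of `b` into the copy.
  refine Finset.sum_nbij' (fun q => (T.piecewise q.1 q.2, T.piecewise q.2 q.1))
    (fun q => (T.piecewise q.1 q.2, T.piecewise q.2 q.1)) (by simp) (by simp)
    (by simp [hmix]) (by simp [hmix]) ?_
  rintro ⟨l, l'⟩ -
  have e1 : a (T.piecewise l l') = a l := ha fun ℓ hℓ => by simp [hℓ]
  have e2 : b (T.piecewise l' l) = b l := hb fun ℓ hℓ => by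
    rw [Set.piecewise_eq_of_notMem _ _ _ hℓ]
  have e3 : (∏ ℓ, p ℓ (T.piecewise l l' ℓ)) * ∏ ℓ, p ℓ (T.piecewise l' l ℓ) =
      (∏ ℓ, p ℓ (l ℓ)) * ∏ ℓ, p ℓ (l' ℓ) := by
    rw [← Finset.prod_mul_distrib, ← Finset.prod_mul_distrib]
    refine Finset.prod_congr rfl fun ℓ _ => ?_
    by_cases h : ℓ ∈ T <;> simp [h, mul_comm]
  simp only [e1, e2]
  linear_combination (-(a l * b l)) * e3

variable {Ω : V → Type*} [∀ v, Fintype (Ω v)]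

/-- The assignments that agree with `z` outside `T`. -/
noncomputable def agreeOutside (T : Finset V) (z : ∀ v, Ω v) : Finset (∀ v, Ω v) :=
  Finset.univ.filter fun x => ∀ v ∉ T, x v = z v

theorem sum_agreeOutside_insert {T : Finset V} {v₀ : V} (hv : v₀ ∉ T) (z : ∀ v, Ω v)
    (f : (∀ v, Ω v) → ℝ) :
    ∑ x ∈ agreeOutside (insert v₀ T) z, f x =
      ∑ x ∈ agreeOutside T z, ∑ a, f (Function.update x v₀ a) := by
  rw [← Finset.sum_product']
  refine Finset.sum_nbij' (fun x => (Function.update x v₀ (z v₀), x v₀))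
    (fun q => Function.update q.1 v₀ q.2) ?_ ?_ ?_ ?_ ?_
  · intro x hx
    simp only [agreeOutside, Finset.mem_filter, Finset.mem_univ, true_and, Finset.mem_product,
      and_true, Finset.mem_insert, not_or, and_imp] at hx ⊢
    intro v hvT
    by_cases h : v = v₀
    · subst h; simp
    · simpa [h] using hx v h hvT
  · rintro ⟨x, a⟩ hx
    simp only [agreeOutside, Finset.mem_filter, Finset.mem_univ, true_and, Finset.mem_product,
      and_true, Finset.mem_insert, not_or, and_imp] at hx ⊢
    intro v h hvT
    simpa [h] using hx v hvT
  · intro x _; simp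
  · rintro ⟨x, a⟩ hx
    simp only [agreeOutside, Finset.mem_filter, Finset.mem_univ, true_and, Finset.mem_product,
      and_true] at hx
    simp only [Function.update_idem, Function.update_self, Prod.mk.injEq, and_true]
    rw [← hx v₀ hv, Function.update_eq_self]
  · intro x _; simp

/-- Conditional distributions that follow the causal order multiply to a distribution. -/
theorem sum_prod_eq_one {L : Type*} (G : CausalStructure V L) (κ : ∀ v, (∀ u, Ω u) → Ω v → ℝ)
    (hκ : ∀ v, DependsOn (κ v) (G.visParents v)) (hκ1 : ∀ v x, ∑ a, κ v x a = 1)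
    (T : Finset V) (z : ∀ v, Ω v) :
    ∑ x ∈ agreeOutside T z, ∏ v ∈ T, κ v x (x v) = 1 := by
  induction hn : T.card generalizing T with
  | zero =>
    obtain rfl := Finset.card_eq_zero.1 hn
    have : agreeOutside ∅ z = {z} := by
      ext x; simp [agreeOutside, funext_iff]
    simp [this]
  | succ n ih =>
    -- No kernel in `T` is conditioned on a sink `v₀`, so the sum over its value meets only its own
    -- kernel and gives one.
    obtain ⟨v₀, hv₀, hsink⟩ := G.exists_sink (T := T) (Finset.card_pos.1 (by omega))
    have hT : insert v₀ (T.erase v₀) = T := Finset.insert_erase hv₀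
    have hcard : (T.erase v₀).card = n := by rw [Finset.card_erase_of_mem hv₀]; omega
    rw [← hT, sum_agreeOutside_insert (Finset.notMem_erase _ _), ← ih _ hcard]
    refine Finset.sum_congr rfl fun x _ => ?_
    have hd : ∀ v ∈ T, ∀ a, κ v (Function.update x v₀ a) = κ v x := fun v hv a =>
      hκ v fun u hu => Function.update_of_ne (by rintro rfl; exact hsink v hv hu) _ _
    have : ∀ a, ∏ v ∈ insert v₀ (T.erase v₀), κ v (Function.update x v₀ a)
        (Function.update x v₀ a v) = κ v₀ x a * ∏ v ∈ T.erase v₀, κ v x (x v) := by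
      intro a
      rw [Finset.prod_insert (Finset.notMem_erase _ _), hd v₀ hv₀, Function.update_self]
      congr 1
      refine Finset.prod_congr rfl fun v hv => ?_
      rw [hd v (Finset.mem_of_mem_erase hv), Function.update_of_ne (Finset.ne_of_mem_erase hv)]
    simp only [this, ← Finset.sum_mul, hκ1, one_mul]

end FiniteLatents

/-! ### Marginalization and the dimension count. -/

section Marginals

open Classical

variable {V : Type*} [Fintype V] {Ω : V → Type*} [∀ v, Fintype (Ω v)]

/-- The marginal on `S'` of a function of the variables in `S`, given those in `T`. -/
noncomputable def marginal (Ω : V → Type*) [∀ v, Fintype (Ω v)] {S' S : Set V} (h : S' ⊆ S)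
    (T : Set V) :
    ((∀ t : T, Ω t) → (∀ s : S, Ω s) → ℝ) →ₗ[ℝ] ((∀ t : T, Ω t) → (∀ s : S', Ω s) → ℝ) where
  toFun p y b := ∑ x : ∀ s : S, Ω s, if (fun s : S' => x ⟨s, h s.2⟩) = b then p y x else 0
  map_add' p q := by
    ext y b
    simp only [Pi.add_apply, ← Finset.sum_add_distrib]
    exact Finset.sum_congr rfl fun x _ => by split_ifs <;> simp
  map_smul' c p := by
    ext y b
    simp only [Pi.smul_apply, smul_eq_mul, RingHom.id_apply, Finset.mul_sum]
    exact Finset.sum_congr rfl fun x _ => by split_ifs <;> simp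

/-- Give the variables of `S` outside `S'` fixed deterministic values. -/
theorem condDistributions_subset_image_marginal [∀ v, Nonempty (Ω v)] {S' S : Set V} (h : S' ⊆ S)
    (T : Set V) :
    condDistributions Ω S' T ⊆ marginal Ω h T '' condDistributions Ω S T := by
  intro q hq
  let e : (∀ s : S', Ω s) → ∀ s : S, Ω s := fun b s =>
    if hs : (s : V) ∈ S' then b ⟨s, hs⟩ else Classical.arbitrary _
  have he : ∀ b, (fun s : S' => e b ⟨s, h s.2⟩) = b := fun b => by
    ext s; simp [e]
  refine ⟨fun y x => ∑ b, if x = e b then q y b else 0, fun y => ⟨fun x => ?_, ?_⟩, ?_⟩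
  · refine Finset.sum_nonneg fun b _ => ?_
    split_ifs
    exacts [(hq y).1 b, le_rfl]
  · rw [Finset.sum_comm, ← (hq y).2]
    exact Finset.sum_congr rfl fun b _ => by simp
  · ext y b
    simp only [marginal, LinearMap.coe_mk, AddHom.coe_mk]
    have : ∀ x : ∀ s : S, Ω s, (if (fun s : S' => x ⟨s, h s.2⟩) = b then
        ∑ b', (if x = e b' then q y b' else 0) else 0) =
        ∑ b', if x = e b' then (if b' = b then q y b' else 0) else 0 := by
      intro x
      split_ifs with hx
      · refine Finset.sum_congr rfl fun b' _ => ?_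
        by_cases hxb : x = e b'
        · have : b' = b := by rw [← hx, hxb, he]
          simp [hxb, this]
        · simp [hxb]
      · refine (Finset.sum_eq_zero fun b' _ => ?_).symm
        by_cases hxb : x = e b'
        · have : b' ≠ b := by rintro rfl; exact hx (by rw [hxb, he])
          simp [this]
        · simp [hxb]
    rw [Finset.sum_congr rfl fun x _ => this x, Finset.sum_comm]
    simp

/-- Rank-nullity for `marginal` on the direction space of all conditional distributions on `S`: its
range contains the directions on `S'`, and its kernel contains those of `X`. -/
theorem finrank_vectorSpan_add_le [∀ v, Nonempty (Ω v)] {S' S : Set V} (h : S' ⊆ S) (T : Set V)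
    {X : Set ((∀ t : T, Ω t) → (∀ s : S, Ω s) → ℝ)} (hX : X ⊆ condDistributions Ω S T)
    (hmarg : ∀ p ∈ X, ∀ q ∈ X, marginal Ω h T p = marginal Ω h T q) :
    Module.finrank ℝ (vectorSpan ℝ X) + affineDimension (condDistributions Ω S' T) ≤
      affineDimension (condDistributions Ω S T) := by
  set P := vectorSpan ℝ (condDistributions Ω S T) with hP
  have h1 := ((marginal Ω h T).domRestrict P).finrank_range_add_finrank_ker
  have h2 : affineDimension (condDistributions Ω S' T) ≤
      Module.finrank ℝ (LinearMap.range ((marginal Ω h T).domRestrict P)) := by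
    refine Submodule.finrank_mono ?_
    rw [vectorSpan_def, Submodule.span_le]
    rintro _ ⟨a, ha, b, hb, rfl⟩
    obtain ⟨a, haS, rfl⟩ := condDistributions_subset_image_marginal h T ha
    obtain ⟨b, hbS, rfl⟩ := condDistributions_subset_image_marginal h T hb
    exact ⟨⟨a - b, vsub_mem_vectorSpan ℝ haS hbS⟩, by simp⟩
  have hXP : vectorSpan ℝ X ≤ P := vectorSpan_mono ℝ hX
  have h3 : Module.finrank ℝ (vectorSpan ℝ X) ≤
      Module.finrank ℝ (LinearMap.ker ((marginal Ω h T).domRestrict P)) := by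
    rw [← (Submodule.comapSubtypeEquivOfLe hXP).finrank_eq]
    refine Submodule.finrank_mono fun v hv => ?_
    have hker : vectorSpan ℝ X ≤ LinearMap.ker (marginal Ω h T) := by
      rw [vectorSpan_def, Submodule.span_le]
      rintro _ ⟨a, ha, b, hb, rfl⟩
      simp [hmarg a ha b hb]
    exact hker hv
  have h4 : affineDimension (condDistributions Ω S T) = Module.finrank ℝ P := rfl
  omega

/-- The assignment with the values `x` on `S`, `y` on `T \ S`, and `z` elsewhere. -/
noncomputable def glue {S T : Set V} (z : ∀ v, Ω v) (y : ∀ t : T, Ω t) (x : ∀ s : S, Ω s) (v : V) :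
    Ω v :=
  if h : v ∈ S then x ⟨v, h⟩ else if h : v ∈ T then y ⟨v, h⟩ else z v

/-- Passes between assignments on a district, where `condDistributions` lives, and global ones,
where kernels are evaluated. -/
theorem sum_glue {S T : Set V} {A : Finset V} (hA : (A : Set V) ⊆ S) (z : ∀ v, Ω v)
    (y : ∀ t : T, Ω t) (c : ∀ s : S, Ω s) (f : (∀ v, Ω v) → ℝ) :
    ∑ x : ∀ s : S, Ω s, (if ∀ s : S, (s : V) ∉ A → x s = c s then f (glue z y x) else 0) =
      ∑ x ∈ agreeOutside A (glue z y c), f x := by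
  rw [← Finset.sum_filter]
  refine Finset.sum_nbij' (fun x => glue z y x) (fun x s => x s) ?_ ?_ ?_ ?_ ?_
  · intro x hx
    simp only [Finset.mem_filter, Finset.mem_univ, true_and, agreeOutside] at hx ⊢
    intro v hv
    by_cases hvS : v ∈ S
    · simpa [glue, hvS] using hx ⟨v, hvS⟩ hv
    · simp [glue, hvS]
  · intro x hx
    simp only [Finset.mem_filter, Finset.mem_univ, true_and, agreeOutside] at hx ⊢
    intro s hs
    rw [hx s hs]
    simp [glue]
  · intro x _
    ext s
    simp [glue]
  · intro x hx
    simp only [Finset.mem_filter, Finset.mem_univ, true_and, agreeOutside] at hx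
    ext v
    by_cases hvS : v ∈ S
    · simp [glue, hvS]
    · rw [hx v fun h => hvS (hA h)]
      simp [glue, hvS]
  · intro x _; rfl

end Marginals

/-! ### Reducing the outcomes of one latent variable, then of all. -/

section Reduction

open Classical

variable {V L : Type*} {Ω : V → Type*} [∀ v, Fintype (Ω v)] {N : ℕ}

/-- Families of kernels for the visible variables, for latent variables with outcomes in `Fin N`,
written as functions of all the variables. -/
abbrev Response (Ω : V → Type*) (L : Type*) (N : ℕ) :=
  ∀ v, (∀ u, Ω u) → (L → Fin N) → Ω v → ℝ

/-- The kernel of `v` depends only on the visible parents of `v` and on the latent variables in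
`P v`. -/
structure IsResponse (G : CausalStructure V L) (P : V → Set L) (ρ : Response Ω L N) : Prop where
  mem : ∀ v x l, ρ v x l ∈ stdSimplex ℝ (Ω v)
  vis : ∀ v, DependsOn (ρ v) (G.visParents v)
  lat : ∀ v x, DependsOn (ρ v x) (P v)

theorem IsResponse.mono {G : CausalStructure V L} {P Q : V → Set L} {ρ : Response Ω L N}
    (h : IsResponse G P ρ) (hPQ : ∀ v, P v ⊆ Q v) : IsResponse G Q ρ :=
  ⟨h.mem, h.vis, fun v x _ _ hl => h.lat v x fun ℓ hℓ => hl ℓ (hPQ v hℓ)⟩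

/-- The responses that agree with `r` except at the children of `ξ`, where they do not depend on
the latent variable `ξ`. -/
def privateResponses (G : CausalStructure V L) (ξ : L) (r : Response Ω L N) :
    Set (Response Ω L N) :=
  {ρ | IsResponse G (fun v => G.latParents v \ {ξ}) ρ ∧ ∀ v, ξ ∉ G.latParents v → ρ v = r v}

theorem convex_privateResponses (G : CausalStructure V L) (ξ : L) (r : Response Ω L N) :
    Convex ℝ (privateResponses G ξ r) := by
  rintro ρ ⟨hρ, hρr⟩ σ ⟨hσ, hσr⟩ a b ha hb hab
  refine ⟨⟨fun v x l => ?_, fun v x x' h => ?_, fun v x l l' h => ?_⟩, fun v hv => ?_⟩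
  · exact convex_stdSimplex ℝ (Ω v) (hρ.mem v x l) (hσ.mem v x l) ha hb hab
  · change a • ρ v x + b • σ v x = a • ρ v x' + b • σ v x'
    rw [hρ.vis v h, hσ.vis v h]
  · change a • ρ v x l + b • σ v x l = a • ρ v x l' + b • σ v x l'
    rw [hρ.lat v x h, hσ.lat v x h]
  · change a • ρ v + b • σ v = r v
    rw [hρr v hv, hσr v hv, ← add_smul, hab, one_smul]

/-- Fixing the value of `ξ` turns a response into a private one. -/
theorem fixLatent_mem_privateResponses {G : CausalStructure V L} {r : Response Ω L N}
    (hr : IsResponse G G.latParents r) (ξ : L) (i : Fin N) :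
    (fun v x l => r v x (Function.update l ξ i)) ∈ privateResponses G ξ r := by
  refine ⟨⟨fun v x l => hr.mem v x _, fun v x x' h => ?_, fun v x l l' h => ?_⟩, fun v hv => ?_⟩
  · funext l
    exact congrFun (hr.vis v h) _
  · refine hr.lat v x fun ℓ hℓ => ?_
    by_cases hξ : ℓ = ξ
    · subst hξ; simp
    · simpa [hξ] using h ℓ ⟨hℓ, hξ⟩
  · funext x l
    exact hr.lat v x fun ℓ hℓ => Function.update_of_ne (by rintro rfl; exact hv hℓ) _ _

/-- Kernels chosen by the value of `ξ` form a response. -/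
theorem isResponse_select {G : CausalStructure V L} {r : Response Ω L N} {ξ : L}
    {ρ : Fin N → Response Ω L N} (hρ : ∀ i, ρ i ∈ privateResponses G ξ r) :
    IsResponse G G.latParents (fun v x l => ρ (l ξ) v x l) := by
  refine ⟨fun v x l => (hρ _).1.mem v x l, fun v x x' h => ?_, fun v x l l' h => ?_⟩
  · funext l
    exact congrFun ((hρ (l ξ)).1.vis v h) l
  · have hind : ∀ i, ρ i v x l = ρ i v x l' := fun i =>
      (hρ i).1.lat v x fun ℓ hℓ => h ℓ hℓ.1
    by_cases hv : ξ ∈ G.latParents v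
    · change ρ (l ξ) v x l = ρ (l' ξ) v x l'
      rw [h ξ hv, hind]
    · change ρ (l ξ) v x l = ρ (l' ξ) v x l'
      rw [hind, (hρ (l ξ)).2 v hv, (hρ (l' ξ)).2 v hv]

variable [Fintype L]

/-- The mean of the product of the kernels of the vertices in `T`. -/
noncomputable def visibleDist (p : L → Fin N → ℝ) (ρ : Response Ω L N) (T : Finset V)
    (x : ∀ v, Ω v) : ℝ :=
  latentMean p fun l => ∏ v ∈ T, ρ v x l (x v)

theorem visibleDist_congr {G : CausalStructure V L} {P : V → Set L} {ρ : Response Ω L N}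
    (hρ : IsResponse G P ρ) (p : L → Fin N → ℝ) {T : Finset V} {x x' : ∀ v, Ω v}
    (h : ∀ v ∈ T, x v = x' v ∧ ∀ u ∈ G.visParents v, x u = x' u) :
    visibleDist p ρ T x = visibleDist p ρ T x' := by
  refine congrArg (latentMean p) (funext fun l => Finset.prod_congr rfl fun v hv => ?_)
  rw [hρ.vis v (h v hv).2, (h v hv).1]

theorem visibleDist_nonneg {G : CausalStructure V L} {P : V → Set L} {ρ : Response Ω L N}
    (hρ : IsResponse G P ρ) {p : L → Fin N → ℝ} (hp : ∀ ℓ, p ℓ ∈ stdSimplex ℝ (Fin N))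
    (T : Finset V) (x : ∀ v, Ω v) : 0 ≤ visibleDist p ρ T x :=
  Finset.sum_nonneg fun l _ => mul_nonneg (Finset.prod_nonneg fun ℓ _ => (hp ℓ).1 _)
    (Finset.prod_nonneg fun v _ => (hρ.mem v x l).1 _)

variable [Fintype V]

/-- The conditional distribution of the variables in the district of `ξ`. -/
noncomputable def districtDist (G : CausalStructure V L) (ξ : L) (z : ∀ v, Ω v)
    (p : L → Fin N → ℝ) (ρ : Response Ω L N) (y : ∀ t : G.districtParents ξ, Ω t)
    (x : ∀ s : G.district ξ, Ω s) : ℝ :=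
  visibleDist p ρ (G.district ξ).toFinset (glue z y x)

/-- The map is polynomial in the kernels but in general not affine, as several children of `ξ` vary
together; its image of a convex set is thus only known to be connected. -/
theorem continuous_districtDist {Ω : V → Type*} (G : CausalStructure V L) (ξ : L) (z : ∀ v, Ω v)
    (p : L → Fin N → ℝ) : Continuous (districtDist G ξ z p : Response Ω L N → _) := by
  refine continuous_pi fun y => continuous_pi fun x => ?_
  unfold districtDist visibleDist latentMean
  fun_prop

/-- A shared latent parent prolongs an alternating path, so no latent variable acts both inside and
outside a district. This is the source of the factorization. -/
theorem CausalStructure.mem_district_of_mem_latParents {V L : Type*} {G : CausalStructure V L}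
    {ξ ℓ : L} {u v : V} (hu : u ∈ G.district ξ) (hℓu : ℓ ∈ G.latParents u)
    (hℓv : ℓ ∈ G.latParents v) : v ∈ G.district ξ := by
  have h1 : G.alternatingGraph.Adj (Sum.inl v) (Sum.inr ℓ) := ⟨by simp, Or.inr hℓv⟩
  have h2 : G.alternatingGraph.Adj (Sum.inr ℓ) (Sum.inl u) := ⟨by simp, Or.inl hℓu⟩
  exact h1.reachable.trans (h2.reachable.trans hu)

theorem CausalStructure.mem_districtDesc_of_child {V L : Type*} {G : CausalStructure V L}
    {ξ : L} {v : V} (hv : ξ ∈ G.latParents v) : v ∈ G.districtDesc ξ := by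
  have h1 : G.alternatingGraph.Adj (Sum.inl v) (Sum.inr ξ) := ⟨by simp, Or.inr hv⟩
  exact ⟨h1.reachable, Relation.TransGen.single hv⟩

/-- The distribution factorizes into the district of `ξ` and the remaining vertices. -/
theorem visibleDist_univ {G : CausalStructure V L} {ρ : Response Ω L N}
    (hρ : IsResponse G G.latParents ρ) {p : L → Fin N → ℝ} (hp : ∀ ℓ, ∑ i, p ℓ i = 1) (ξ : L)
    (z x : ∀ v, Ω v) :
    visibleDist p ρ Finset.univ x =
      districtDist G ξ z p ρ (fun t => x t) (fun s => x s) *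
        visibleDist p ρ (G.district ξ).toFinsetᶜ x := by
  have h1 : districtDist G ξ z p ρ (fun t => x t) (fun s => x s) =
      visibleDist p ρ (G.district ξ).toFinset x := by
    have hglue : ∀ v, v ∈ G.district ξ ∨ v ∈ G.districtParents ξ →
        glue z (fun t : G.districtParents ξ => x t) (fun s : G.district ξ => x s) v = x v := by
      intro v hv
      by_cases h : v ∈ G.district ξ
      · simp [glue, h]
      · simp [glue, h, hv.resolve_left h]
    refine visibleDist_congr hρ p fun v hv => ?_
    rw [Set.mem_toFinset] at hv
    refine ⟨hglue v (Or.inl hv), fun u hu => hglue u ?_⟩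
    by_cases h : u ∈ G.district ξ
    · exact Or.inl h
    · exact Or.inr ⟨⟨v, hv, hu⟩, h⟩
  rw [h1, visibleDist, visibleDist, visibleDist,
    ← latentMean_mul hp {ℓ | ∃ v ∈ G.district ξ, ℓ ∈ G.latParents v}]
  · simp only [Finset.prod_mul_prod_compl]
  · intro l l' h
    refine Finset.prod_congr rfl fun v hv => ?_
    rw [hρ.lat v x fun ℓ hℓ => h ℓ ⟨v, Set.mem_toFinset.1 hv, hℓ⟩]
  · intro l l' h
    refine Finset.prod_congr rfl fun v hv => ?_
    rw [hρ.lat v x fun ℓ hℓ => h ℓ ?_]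
    rintro ⟨u, hu, hℓu⟩
    rw [Finset.mem_compl, Set.mem_toFinset] at hv
    exact hv (CausalStructure.mem_district_of_mem_latParents hu hℓu hℓ)

/-- Summing over the variables in `A` removes their kernels, if `A` contains no parent of the
remaining vertices. -/
theorem sum_visibleDist {G : CausalStructure V L} {P : V → Set L} {ρ : Response Ω L N}
    (hρ : IsResponse G P ρ) (p : L → Fin N → ℝ) {A T : Finset V} (hAT : A ⊆ T)
    (hA : ∀ v ∈ T \ A, ∀ u ∈ A, u ∉ G.visParents v) (z : ∀ v, Ω v) :
    ∑ x ∈ agreeOutside A z, visibleDist p ρ T x = visibleDist p ρ (T \ A) z := by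
  simp only [visibleDist, latentMean]
  rw [Finset.sum_comm]
  refine Finset.sum_congr rfl fun l _ => ?_
  rw [← Finset.mul_sum]
  congr 1
  have : ∀ x ∈ agreeOutside A z, ∏ v ∈ T, ρ v x l (x v) =
      (∏ v ∈ T \ A, ρ v z l (z v)) * ∏ v ∈ A, ρ v x l (x v) := by
    intro x hx
    simp only [Finset.mem_filter, Finset.mem_univ, true_and, agreeOutside] at hx
    rw [← Finset.prod_sdiff hAT]
    congr 1
    refine Finset.prod_congr rfl fun v hv => ?_
    rw [hρ.vis v fun u hu => hx u fun h => hA v hv u h hu, hx v (Finset.mem_sdiff.1 hv).2]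
  rw [Finset.sum_congr rfl this, ← Finset.mul_sum,
    sum_prod_eq_one G (fun v x => ρ v x l) (fun v x x' h => congrFun (hρ.vis v h) l)
      (fun v x => (hρ.mem v x l).2), mul_one]

/-- Normalization is `sum_visibleDist` with the whole district summed out, leaving the mean of an
empty product. -/
theorem districtDist_mem {G : CausalStructure V L} {P : V → Set L} {ρ : Response Ω L N}
    (hρ : IsResponse G P ρ) {p : L → Fin N → ℝ} (hp : ∀ ℓ, p ℓ ∈ stdSimplex ℝ (Fin N)) (ξ : L)
    (z : ∀ v, Ω v) :
    districtDist G ξ z p ρ ∈ condDistributions Ω (G.district ξ) (G.districtParents ξ) := by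
  refine fun y => ⟨fun x => visibleDist_nonneg hρ hp _ _, ?_⟩
  have h := sum_glue (S := G.district ξ) (T := G.districtParents ξ)
    (A := (G.district ξ).toFinset) (by simp) z y (fun s => z s)
    (visibleDist p ρ (G.district ξ).toFinset)
  rw [sum_visibleDist hρ p (Finset.Subset.refl _) (by simp)] at h
  have h0 : ∀ s : G.district ξ, (s : V) ∈ G.district ξ := fun s => s.2
  simp only [Set.mem_toFinset, h0, not_true_eq_false, false_imp_iff, implies_true, if_true,
    Finset.sdiff_self] at h
  change ∑ x, visibleDist p ρ (G.district ξ).toFinset (glue z y x) = 1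
  rw [h, visibleDist]
  simpa using latentMean_const (fun ℓ => (hp ℓ).2) 1

/-- Children of descendants of `ξ` are descendants, so the descendants in the district can be summed
out and only the kernels of the non-descendants survive. -/
theorem marginal_districtDist {G : CausalStructure V L} {P : V → Set L} {ρ : Response Ω L N}
    (hρ : IsResponse G P ρ) (p : L → Fin N → ℝ) (ξ : L) (z : ∀ v, Ω v)
    (h : G.districtNonDesc ξ ⊆ G.district ξ) (y : ∀ t : G.districtParents ξ, Ω t)
    (b : ∀ s : G.districtNonDesc ξ, Ω s) :
    marginal Ω h (G.districtParents ξ) (districtDist G ξ z p ρ) y b =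
      visibleDist p ρ (G.districtNonDesc ξ).toFinset (glue z y
        fun s : G.district ξ => if hs : (s : V) ∈ G.districtNonDesc ξ then b ⟨s, hs⟩ else z s) := by
  have hsd : (G.district ξ).toFinset \ (G.districtDesc ξ).toFinset =
      (G.districtNonDesc ξ).toFinset := by
    ext v
    simp only [Finset.mem_sdiff, Set.mem_toFinset]
    rfl
  have hsub : G.districtDesc ξ ⊆ G.district ξ := fun v hv => hv.1
  rw [← hsd, ← sum_visibleDist hρ p (Set.toFinset_subset_toFinset.2 hsub), ← sum_glue]
  · simp only [marginal, LinearMap.coe_mk, AddHom.coe_mk]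
    refine Finset.sum_congr rfl fun x _ => if_congr ?_ rfl rfl
    constructor
    · rintro rfl s hs
      have : (s : V) ∈ G.districtNonDesc ξ := ⟨s.2, by simpa using hs⟩
      simp [this]
    · intro hx
      funext s
      have := hx ⟨s, h s.2⟩ (by simpa using s.2.2)
      simpa using this
  · simpa using hsub
  · intro v hv u hu huv
    simp only [Finset.mem_sdiff, Set.mem_toFinset] at hv hu
    exact hv.2 ⟨hv.1, hu.2.tail huv⟩

/-- The bound on the number of outcomes of the latent variable `ξ`. -/
noncomputable def outcomeBound (G : CausalStructure V L) (Ω : V → Type*) [∀ v, Fintype (Ω v)]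
    (ξ : L) : ℕ :=
  max 1 (affineDimension (condDistributions Ω (G.district ξ) (G.districtParents ξ)) -
    affineDimension (condDistributions Ω (G.districtNonDesc ξ) (G.districtParents ξ)))

/-- Non-descendants of `ξ` are not its children, so private responses agree with `r` there and have
a common marginal; the dimension count applies. -/
theorem finrank_vectorSpan_districtDist_le (G : CausalStructure V L) {p : L → Fin N → ℝ}
    (hp : ∀ ℓ, p ℓ ∈ stdSimplex ℝ (Fin N)) (ξ : L) (z : ∀ v, Ω v) (r : Response Ω L N) :
    max 1 (Module.finrank ℝ (vectorSpan ℝ (districtDist G ξ z p '' privateResponses G ξ r))) ≤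
      outcomeBound G Ω ξ := by
  have : ∀ v, Nonempty (Ω v) := fun v => ⟨z v⟩
  have h : G.districtNonDesc ξ ⊆ G.district ξ := Set.sdiff_subset
  have := finrank_vectorSpan_add_le h (G.districtParents ξ)
    (X := districtDist G ξ z p '' privateResponses G ξ r) ?_ ?_
  · exact max_le_max le_rfl (by omega)
  · rintro _ ⟨ρ, hρ, rfl⟩
    exact districtDist_mem hρ.1 hp ξ z
  · rintro _ ⟨ρ, hρ, rfl⟩ _ ⟨σ, hσ, rfl⟩
    ext y b
    rw [marginal_districtDist hρ.1, marginal_districtDist hσ.1]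
    refine congrArg _ (funext fun l => Finset.prod_congr rfl fun v hv => ?_)
    have hv' : ξ ∉ G.latParents v := fun hξ =>
      (Set.mem_toFinset.1 hv).2 (CausalStructure.mem_districtDesc_of_child hξ)
    rw [hρ.2 v hv', hσ.2 v hv']

/-- If `ξ` has weights `w` and selects the responses `ρ i`, then the distribution is the mixture of
those of the responses `ρ i`, times a factor independent of the responses. -/
theorem visibleDist_select {G : CausalStructure V L} {p : L → Fin N → ℝ}
    (hp : ∀ ℓ, p ℓ ∈ stdSimplex ℝ (Fin N)) {ξ : L} {r : Response Ω L N}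
    {ρ : Fin N → Response Ω L N} (hρ : ∀ i, ρ i ∈ privateResponses G ξ r) (w : Fin N → ℝ)
    (z x : ∀ v, Ω v) :
    visibleDist (Function.update p ξ w) (fun v x l => ρ (l ξ) v x l) Finset.univ x =
      (∑ i, w i • districtDist G ξ z p (ρ i)) (fun t => x t) (fun s => x s) *
        visibleDist p r (G.district ξ).toFinsetᶜ x := by
  rw [visibleDist, latentMean_update fun ℓ => (hp ℓ).2]
  simp only [Finset.sum_apply, Pi.smul_apply, smul_eq_mul, Finset.sum_mul]
  refine Finset.sum_congr rfl fun i _ => ?_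
  rw [mul_assoc]
  congr 1
  have h1 : visibleDist p (ρ i) (G.district ξ).toFinsetᶜ x =
      visibleDist p r (G.district ξ).toFinsetᶜ x := by
    refine congrArg _ (funext fun l => Finset.prod_congr rfl fun v hv => ?_)
    rw [(hρ i).2 v fun hξ => ?_]
    rw [Finset.mem_compl, Set.mem_toFinset] at hv
    exact hv (CausalStructure.mem_districtDesc_of_child hξ).1
  -- Each `ρ i` ignores `ξ`, so setting that coordinate to `i` or leaving it to `p ξ` makes no
  -- difference.
  rw [← h1, ← visibleDist_univ ((hρ i).1.mono fun v => Set.sdiff_subset) fun ℓ => (hp ℓ).2]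
  refine congrArg _ (funext fun l => Finset.prod_congr rfl fun v _ => ?_)
  simp only [Function.update_self]
  refine congrFun ((hρ i).1.lat v x fun ℓ hℓ => ?_) _
  exact Function.update_of_ne hℓ.2 _ _

/-- One latent variable can be given few outcomes. -/
theorem exists_reduce_latent {G : CausalStructure V L} {p : L → Fin N → ℝ}
    (hp : ∀ ℓ, p ℓ ∈ stdSimplex ℝ (Fin N)) {r : Response Ω L N}
    (hr : IsResponse G G.latParents r) (z : ∀ v, Ω v) (ξ : L) (hN : outcomeBound G Ω ξ ≤ N) :
    ∃ w ∈ stdSimplex ℝ (Fin N), (∀ i : Fin N, outcomeBound G Ω ξ ≤ i → w i = 0) ∧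
      ∃ r' : Response Ω L N, IsResponse G G.latParents r' ∧
        visibleDist (Function.update p ξ w) r' Finset.univ = visibleDist p r Finset.univ := by
  let r₀ : Fin N → Response Ω L N := fun i v x l => r v x (Function.update l ξ i)
  have hr₀ : ∀ i, r₀ i ∈ privateResponses G ξ r := fixLatent_mem_privateResponses hr ξ
  have hS : IsPreconnected (districtDist G ξ z p '' privateResponses G ξ r) :=
    (convex_privateResponses G ξ r).isPreconnected.image _
      (continuous_districtDist G ξ z p).continuousOn
  have hmem : ∑ i, p ξ i • districtDist G ξ z p (r₀ i) ∈
      convexHull ℝ (districtDist G ξ z p '' privateResponses G ξ r) :=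
    (convex_convexHull ℝ _).sum_mem (fun i _ => (hp ξ).1 i) (hp ξ).2 fun i _ =>
      subset_convexHull ℝ _ ⟨_, hr₀ i, rfl⟩
  -- Total mass at one conditioning value; it puts all conditional distributions in the hyperplane
  -- `φ = 1`.
  let φ : ((∀ t : G.districtParents ξ, Ω t) → (∀ s : G.district ξ, Ω s) → ℝ) →ₗ[ℝ] ℝ :=
    (∑ x, LinearMap.proj x) ∘ₗ LinearMap.proj fun t : G.districtParents ξ => z t
  have hφ : ∀ s ∈ districtDist G ξ z p '' privateResponses G ξ r, φ s = 1 := by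
    rintro _ ⟨ρ, hρ, rfl⟩
    have := (districtDist_mem hρ.1 hp ξ z fun t => z t).2
    simpa [φ] using this
  have hb := finrank_vectorSpan_districtDist_le G hp ξ z r
  obtain ⟨q, w, hq, hw, hw0, hqw⟩ := isCombination_of_isPreconnected φ hS hφ hmem (hb.trans hN)
  choose ρ hρ hρq using hq
  refine ⟨w, hw, fun i hi => hw0 i (hb.trans hi), fun v x l => ρ (l ξ) v x l,
    isResponse_select hρ, funext fun x => ?_⟩
  -- The new model selects the Fenchel–Bunt points, the old one selects its own slices `r₀` with
  -- weights `p ξ`; both mixtures are the same point of the hull.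
  have h1 := visibleDist_select hp hρ w z x
  have h2 := visibleDist_select hp hr₀ (p ξ) z x
  simp only [hρq, hqw] at h1
  rw [h1, ← h2, Function.update_eq_self]
  simp only [r₀, Function.update_eq_self]

/-- All latent variables can be given few outcomes. -/
theorem exists_reduce_latents {G : CausalStructure V L} {p : L → Fin N → ℝ}
    (hp : ∀ ℓ, p ℓ ∈ stdSimplex ℝ (Fin N)) {r : Response Ω L N}
    (hr : IsResponse G G.latParents r) (z : ∀ v, Ω v) (hN : ∀ ξ, outcomeBound G Ω ξ ≤ N) :
    ∃ p' : L → Fin N → ℝ, (∀ ℓ, p' ℓ ∈ stdSimplex ℝ (Fin N)) ∧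
      (∀ ξ (i : Fin N), outcomeBound G Ω ξ ≤ i → p' ξ i = 0) ∧
      ∃ r' : Response Ω L N, IsResponse G G.latParents r' ∧
        visibleDist p' r' Finset.univ = visibleDist p r Finset.univ := by
  suffices H : ∀ s : Finset L, ∃ p' : L → Fin N → ℝ, (∀ ℓ, p' ℓ ∈ stdSimplex ℝ (Fin N)) ∧
      (∀ ξ ∈ s, ∀ i : Fin N, outcomeBound G Ω ξ ≤ i → p' ξ i = 0) ∧
      ∃ r' : Response Ω L N, IsResponse G G.latParents r' ∧
        visibleDist p' r' Finset.univ = visibleDist p r Finset.univ by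
    simpa using H Finset.univ
  intro s
  induction s using Finset.induction_on with
  | empty => exact ⟨p, hp, by simp, r, hr, rfl⟩
  | insert ξ s hξ ih =>
    obtain ⟨p', hp', hs, r', hr', h⟩ := ih
    obtain ⟨w, hw, hw0, r'', hr'', h'⟩ := exists_reduce_latent hp' hr' z ξ (hN ξ)
    -- All kernels may have changed, but only the weights of `ξ` did, so the earlier zeros persist.
    refine ⟨Function.update p' ξ w, fun ℓ => ?_, fun ℓ hℓ i hi => ?_, r'', hr'', h'.trans h⟩
    · by_cases e : ℓ = ξ
      · subst e; simpa using hw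
      · simpa [e] using hp' ℓ
    · by_cases e : ℓ = ξ
      · subst e; simpa using hw0 i hi
      · simpa [e] using hs ℓ (Finset.mem_of_mem_insert_of_ne hℓ e) i hi

end Reduction

/-! ### Replacing arbitrary latent spaces by finite ones. -/

section FiniteSupport

open Classical

/-- The measure with weights `w` on `Fin n`. -/
noncomputable def weightMeasure {n : ℕ} (w : Fin n → ℝ) : Measure (Fin n) :=
  ∑ i, ENNReal.ofReal (w i) • Measure.dirac i

theorem weightMeasure_singleton {n : ℕ} (w : Fin n → ℝ) (i : Fin n) :
    weightMeasure w {i} = ENNReal.ofReal (w i) := by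
  simp [weightMeasure, Set.indicator_apply]

theorem isProbabilityMeasure_weightMeasure {n : ℕ} {w : Fin n → ℝ}
    (hw : w ∈ stdSimplex ℝ (Fin n)) : IsProbabilityMeasure (weightMeasure w) := by
  refine ⟨?_⟩
  simp only [weightMeasure, Measure.coe_finsetSum, Measure.coe_smul, Finset.sum_apply,
    Pi.smul_apply, measure_univ, smul_eq_mul, mul_one]
  rw [← ENNReal.ofReal_sum_of_nonneg fun i _ => hw.1 i, hw.2, ENNReal.ofReal_one]

theorem integral_weightMeasure {n : ℕ} {w : Fin n → ℝ} (hw : w ∈ stdSimplex ℝ (Fin n))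
    {E : Type*} [NormedAddCommGroup E] [NormedSpace ℝ E] [CompleteSpace E] (f : Fin n → E) :
    ∫ i, f i ∂weightMeasure w = ∑ i, w i • f i := by
  have := isProbabilityMeasure_weightMeasure hw
  rw [integral_fintype .of_finite]
  refine Finset.sum_congr rfl fun i _ => ?_
  rw [measureReal_def, weightMeasure_singleton, ENNReal.toReal_ofReal (hw.1 i)]

theorem isProbabilityMeasure_update {L : Type*} {Λ : L → Type*}
    [∀ ℓ, MeasurableSpace (Λ ℓ)] (μ : ∀ ℓ, Measure (Λ ℓ)) [∀ ℓ, IsProbabilityMeasure (μ ℓ)]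
    (ξ : L) (ν : Measure (Λ ξ)) [hν : IsProbabilityMeasure ν] (ℓ : L) :
    IsProbabilityMeasure (Function.update μ ξ ν ℓ) := by
  by_cases h : ℓ = ξ
  · subst h; simpa using hν
  · rw [Function.update_of_ne h]; infer_instance

variable {L : Type*} [Fintype L]

theorem integral_pi_weightMeasure {k : L → ℕ} {w : ∀ ℓ, Fin (k ℓ) → ℝ}
    (hw : ∀ ℓ, w ℓ ∈ stdSimplex ℝ (Fin (k ℓ)))
    {E : Type*} [NormedAddCommGroup E] [NormedSpace ℝ E] [CompleteSpace E]
    (f : (∀ ℓ, Fin (k ℓ)) → E) :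
    ∫ l, f l ∂(Measure.pi fun ℓ => weightMeasure (w ℓ)) = ∑ l, (∏ ℓ, w ℓ (l ℓ)) • f l := by
  have := fun ℓ => isProbabilityMeasure_weightMeasure (hw ℓ)
  rw [integral_fintype .of_finite]
  refine Finset.sum_congr rfl fun l _ => ?_
  rw [measureReal_def, Measure.pi_singleton, ENNReal.toReal_prod]
  congr 1
  refine Finset.prod_congr rfl fun ℓ _ => ?_
  rw [weightMeasure_singleton, ENNReal.toReal_ofReal ((hw ℓ).1 _)]

variable {Λ : L → Type*} [∀ ℓ, MeasurableSpace (Λ ℓ)]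

theorem map_update_prod (μ : ∀ ℓ, Measure (Λ ℓ)) [∀ ℓ, IsProbabilityMeasure (μ ℓ)]
    (ξ : L) (ν : Measure (Λ ξ)) [IsProbabilityMeasure ν] :
    ((Measure.pi μ).prod ν).map (fun q => Function.update q.1 ξ q.2) =
      Measure.pi (Function.update μ ξ ν) := by
  have := isProbabilityMeasure_update μ ξ ν
  have hmeas : Measurable fun q : (∀ ℓ, Λ ℓ) × Λ ξ => Function.update q.1 ξ q.2 := by
    fun_prop
  refine (Measure.pi_eq fun s hs => ?_).symm
  rw [Measure.map_apply hmeas (MeasurableSet.univ_pi hs)]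
  have hpre : (fun q : (∀ ℓ, Λ ℓ) × Λ ξ => Function.update q.1 ξ q.2) ⁻¹' Set.univ.pi s =
      Set.univ.pi (Function.update s ξ Set.univ) ×ˢ s ξ := by
    ext ⟨l, a⟩
    simp only [Set.mem_preimage, Set.mem_univ_pi, Set.mem_prod]
    constructor
    · intro h
      refine ⟨fun ℓ => ?_, by simpa using h ξ⟩
      by_cases e : ℓ = ξ
      · subst e; simp
      · simpa [e] using h ℓ
    · rintro ⟨h, ha⟩ ℓ
      by_cases e : ℓ = ξ
      · subst e; simpa using ha
      · simpa [e] using h ℓ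
  rw [hpre, Measure.prod_prod, Measure.pi_pi, ← Finset.mul_prod_erase _ _ (Finset.mem_univ ξ),
    ← Finset.mul_prod_erase _ (fun ℓ => Function.update μ ξ ν ℓ (s ℓ)) (Finset.mem_univ ξ)]
  simp only [Function.update_self, measure_univ, one_mul]
  rw [mul_comm]
  congr 1
  refine Finset.prod_congr rfl fun ℓ hℓ => ?_
  rw [Function.update_of_ne (Finset.ne_of_mem_erase hℓ),
    Function.update_of_ne (Finset.ne_of_mem_erase hℓ)]

variable {ι : Type*} [Fintype ι]

/-- Fubini after redrawing the coordinate `ξ` from `ν`; boundedness supplies integrability. -/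
theorem integral_pi_update (μ : ∀ ℓ, Measure (Λ ℓ)) [∀ ℓ, IsProbabilityMeasure (μ ℓ)]
    (ξ : L) (ν : Measure (Λ ξ)) [IsProbabilityMeasure ν] {F : (∀ ℓ, Λ ℓ) → ι → ℝ}
    (hF : Measurable F) {C : ℝ} (hC : ∀ l, ‖F l‖ ≤ C) :
    Integrable (fun a => ∫ l, F (Function.update l ξ a) ∂Measure.pi μ) ν ∧
    ∫ l, F l ∂Measure.pi (Function.update μ ξ ν) =
      ∫ a, ∫ l, F (Function.update l ξ a) ∂Measure.pi μ ∂ν := by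
  have hmeas : Measurable fun q : (∀ ℓ, Λ ℓ) × Λ ξ => Function.update q.1 ξ q.2 := by
    fun_prop
  have hint : Integrable (fun q : (∀ ℓ, Λ ℓ) × Λ ξ => F (Function.update q.1 ξ q.2))
      ((Measure.pi μ).prod ν) :=
    Integrable.of_bound (hF.comp hmeas).aestronglyMeasurable C (.of_forall fun q => hC _)
  refine ⟨hint.integral_prod_right, ?_⟩
  rw [← map_update_prod, integral_map hmeas.aemeasurable hF.aestronglyMeasurable,
    integral_prod_symm _ hint]

/-- The mean of finitely many bounded functions of independent variables is attained by independent
variables with finitely many values. -/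
theorem exists_latentMean_eq (μ : ∀ ℓ, Measure (Λ ℓ)) [∀ ℓ, IsProbabilityMeasure (μ ℓ)]
    {F : (∀ ℓ, Λ ℓ) → ι → ℝ} (hF : Measurable F) {C : ℝ} (hC : ∀ l, ‖F l‖ ≤ C) {N : ℕ}
    (hN : Fintype.card ι + 1 ≤ N) :
    ∃ (p : L → Fin N → ℝ) (a : ∀ ℓ, Fin N → Λ ℓ), (∀ ℓ, p ℓ ∈ stdSimplex ℝ (Fin N)) ∧
      ∀ i, ∫ l, F l i ∂Measure.pi μ = latentMean p fun l => F (fun ℓ => a ℓ (l ℓ)) i := by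
  have H : ∀ s : Finset L, ∃ μ' : ∀ ℓ, Measure (Λ ℓ), (∀ ℓ, IsProbabilityMeasure (μ' ℓ)) ∧
      ∫ l, F l ∂Measure.pi μ' = ∫ l, F l ∂Measure.pi μ ∧
      ∀ ℓ ∈ s, ∃ w ∈ stdSimplex ℝ (Fin N), ∃ a : Fin N → Λ ℓ,
        μ' ℓ = (weightMeasure w).map a := by
    intro s
    induction s using Finset.induction_on with
    | empty => exact ⟨μ, inferInstance, rfl, by simp⟩
    | insert ξ s hξ ih =>
      obtain ⟨μ', hμ', heq, hs⟩ := ih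
      -- With the other latents averaged out, only the mean of `g` in `ι → ℝ` must be preserved, for
      -- which `Fintype.card ι + 1` values of `ξ` suffice.
      let g : Λ ξ → ι → ℝ := fun a => ∫ l, F (Function.update l ξ a) ∂Measure.pi μ'
      obtain ⟨hgi, hg⟩ := integral_pi_update μ' ξ (μ' ξ) hF hC
      rw [Function.update_eq_self] at hg
      have hmem : ∫ a, g a ∂μ' ξ ∈ convexHull ℝ (Set.range g) :=
        integral_mem_of_convex (μ' ξ) _ _ g rfl (convex_convexHull ℝ _) hgi
          (.of_forall fun a => subset_convexHull ℝ _ ⟨a, rfl⟩)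
      obtain ⟨z, w, hz, hw, -, hzw⟩ := isCombination_of_mem_convexHull hmem
        (N := N) (by rwa [Module.finrank_fintype_fun_eq_card])
      choose a ha using hz
      have := isProbabilityMeasure_weightMeasure hw
      have ham : Measurable a := .of_discrete
      have : IsProbabilityMeasure ((weightMeasure w).map a) :=
        Measure.isProbabilityMeasure_map ham.aemeasurable
      refine ⟨Function.update μ' ξ ((weightMeasure w).map a),
        isProbabilityMeasure_update μ' ξ _, ?_, fun ℓ hℓ => ?_⟩
      · obtain ⟨hgi', hg'⟩ := integral_pi_update μ' ξ ((weightMeasure w).map a) hF hC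
        rw [hg', integral_map ham.aemeasurable hgi'.aestronglyMeasurable,
          integral_weightMeasure hw, ← heq, hg, ← hzw]
        exact Finset.sum_congr rfl fun i _ => by rw [← ha]
      · by_cases e : ℓ = ξ
        · subst e
          exact ⟨w, hw, a, by simp⟩
        · rw [Function.update_of_ne e]
          exact hs ℓ (Finset.mem_of_mem_insert_of_ne hℓ e)
  obtain ⟨μ', hμ', heq, h⟩ := H Finset.univ
  choose w hw a ha using fun ℓ => h ℓ (Finset.mem_univ ℓ)
  obtain rfl : μ' = fun ℓ => (weightMeasure (w ℓ)).map (a ℓ) := funext ha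
  have := fun ℓ => isProbabilityMeasure_weightMeasure (hw ℓ)
  have ham : ∀ ℓ, Measurable (a ℓ) := fun ℓ => .of_discrete
  have hint : Integrable F (Measure.pi μ) :=
    .of_bound hF.aestronglyMeasurable C (.of_forall hC)
  refine ⟨w, a, hw, fun i => ?_⟩
  have hmap : Measurable fun (l : L → Fin N) ℓ => a ℓ (l ℓ) := .of_discrete
  rw [← Measure.pi_map_pi fun ℓ => (ham ℓ).aemeasurable, integral_map hmap.aemeasurable
    hF.aestronglyMeasurable, integral_pi_weightMeasure hw] at heq
  have h1 := (ContinuousLinearMap.proj (R := ℝ) (φ := fun _ : ι => ℝ) i).integral_comp_comm hint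
  simp only [ContinuousLinearMap.proj_apply] at h1
  rw [h1, ← heq]
  simp [latentMean]

end FiniteSupport

/-! ### Between causal models and finite weights with kernels. -/

section Main

open Classical

variable {V L : Type*} [Fintype V] [Fintype L] {G : CausalStructure V L}
  {Ω : V → Type*} [∀ v, Fintype (Ω v)] {Λ : L → Type*} [∀ ℓ, MeasurableSpace (Λ ℓ)]

theorem CausalModel.nonempty_latent {V L : Type*} {G : CausalStructure V L} {Ω : V → Type*}
    [∀ v, Fintype (Ω v)] {Λ : L → Type*} [∀ ℓ, MeasurableSpace (Λ ℓ)] (M : CausalModel G Ω Λ)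
    (ℓ : L) : Nonempty (Λ ℓ) :=
  nonempty_of_isProbabilityMeasure (M.latent ℓ : Measure (Λ ℓ))

/-- Induction along the causal order: once the parents have values, the kernel is a point of a
simplex, which is empty over an empty set. -/
theorem CausalModel.nonempty_visible {V L : Type*} [Finite V] {G : CausalStructure V L}
    {Ω : V → Type*} [∀ v, Fintype (Ω v)] {Λ : L → Type*} [∀ ℓ, MeasurableSpace (Λ ℓ)]
    (M : CausalModel G Ω Λ) (v : V) : Nonempty (Ω v) := by
  let R : V → V → Prop := fun u v => Relation.TransGen G.Adj (Sum.inl u) (Sum.inl v)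
  have : IsTrans V R := ⟨fun _ _ _ h h' => h.trans h'⟩
  have : Std.Irrefl R := ⟨fun v => G.acyclic (Sum.inl v)⟩
  refine (Finite.wellFounded_of_trans_of_irrefl R).induction (C := fun v => Nonempty (Ω v)) v
    fun v ih => ?_
  have y : ∀ u : G.visParents v, Ω u := fun u => (ih u (Relation.TransGen.single u.2)).some
  have l : ∀ ℓ : G.latParents v, Λ ℓ := fun ℓ => (M.nonempty_latent ℓ).some
  by_contra h
  have := not_nonempty_iff.1 h
  simpa using (M.response_mem v y l).2

/-- A causal model is equivalent to one with finitely many latent outcomes. -/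
theorem CausalModel.exists_visibleDist_eq (M : CausalModel G Ω Λ) {N : ℕ}
    (hN : Fintype.card (∀ v, Ω v) + 1 ≤ N) :
    ∃ (p : L → Fin N → ℝ) (r : Response Ω L N), (∀ ℓ, p ℓ ∈ stdSimplex ℝ (Fin N)) ∧
      IsResponse G G.latParents r ∧ visibleDist p r Finset.univ = M.observed := by
  let F : (∀ ℓ, Λ ℓ) → (∀ v, Ω v) → ℝ := fun l x =>
    ∏ v, M.response v (fun u => x u) (fun ℓ => l ℓ) (x v)
  have hF : Measurable F := by
    refine measurable_pi_lambda _ fun x => Finset.measurable_prod _ fun v _ => ?_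
    exact (M.response_measurable v (fun u => x u) (x v)).comp
      (measurable_pi_lambda _ fun ℓ => measurable_pi_apply _)
  have hC : ∀ l, ‖F l‖ ≤ 1 := by
    intro l
    refine (pi_norm_le_iff_of_nonneg zero_le_one).2 fun x => ?_
    have h0 : 0 ≤ F l x := Finset.prod_nonneg fun v _ => (M.response_mem v _ _).1 _
    rw [Real.norm_of_nonneg h0]
    refine Finset.prod_le_one (fun v _ => (M.response_mem v _ _).1 _) fun v _ => ?_
    rw [← (M.response_mem v (fun u => x u) fun ℓ => l ℓ).2]
    exact Finset.single_le_sum (fun a _ => (M.response_mem v _ _).1 a) (Finset.mem_univ _)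
  obtain ⟨p, a, hp, h⟩ :=
    exists_latentMean_eq (fun ℓ => (M.latent ℓ : Measure (Λ ℓ))) hF hC hN
  refine ⟨p, fun v x l => M.response v (fun u => x u) (fun ℓ => a ℓ (l ℓ)), hp,
    ⟨fun v x l => M.response_mem _ _ _, fun v x x' hx => ?_, fun v x l l' hl => ?_⟩,
    funext fun x => (h x).symm⟩
  · have : (fun u : G.visParents v => x u) = fun u : G.visParents v => x' u := funext fun u => hx u u.2
    simp only [this]
  · have : (fun ℓ : G.latParents v => a ℓ (l ℓ)) =
        fun ℓ : G.latParents v => a ℓ (l' ℓ) :=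
      funext fun ℓ => by rw [hl ℓ ℓ.2]
    simp only [this]

/-- A finite model whose weights vanish from `k ℓ` on is a causal model with `k ℓ` outcomes. -/
theorem exists_causalModel {N : ℕ} {p : L → Fin N → ℝ} (hp : ∀ ℓ, p ℓ ∈ stdSimplex ℝ (Fin N))
    {r : Response Ω L N} (hr : IsResponse G G.latParents r) (z : ∀ v, Ω v) {k : L → ℕ}
    (hk : ∀ ℓ, k ℓ ≤ N) (hpk : ∀ ℓ (i : Fin N), k ℓ ≤ i → p ℓ i = 0) :
    ∃ M : CausalModel G Ω (fun ℓ => Fin (k ℓ)), M.observed = visibleDist p r Finset.univ := by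
  have hout : ∀ ℓ i, i ∉ Set.range (Fin.castLE (hk ℓ)) → p ℓ i = 0 := fun ℓ i hi =>
    hpk ℓ i (not_lt.1 fun h => hi ⟨⟨i, h⟩, rfl⟩)
  have hw : ∀ ℓ, (fun i => p ℓ (Fin.castLE (hk ℓ) i)) ∈ stdSimplex ℝ (Fin (k ℓ)) := fun ℓ =>
    ⟨fun i => (hp ℓ).1 _, by
      rw [← (hp ℓ).2]
      exact Fintype.sum_of_injective _ (Fin.castLE_injective (hk ℓ)) _ _ (hout ℓ) fun i => rfl⟩
  have hne : ∀ ℓ : L, Nonempty (Fin N) := fun ℓ => by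
    by_contra h
    have := not_nonempty_iff.1 h
    simpa using (hp ℓ).2
  -- The values off the parents are arbitrary, since `r v` never reads them.
  let extV : ∀ v, (∀ u : G.visParents v, Ω u) → ∀ u, Ω u := fun v y u =>
    if h : u ∈ G.visParents v then y ⟨u, h⟩ else z u
  let extL : ∀ v, (∀ ℓ : G.latParents v, Fin (k ℓ)) → L → Fin N := fun v l ℓ =>
    if h : ℓ ∈ G.latParents v then Fin.castLE (hk ℓ) (l ⟨ℓ, h⟩) else (hne ℓ).some
  refine ⟨⟨fun ℓ => ⟨weightMeasure fun i => p ℓ (Fin.castLE (hk ℓ) i),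
    isProbabilityMeasure_weightMeasure (hw ℓ)⟩, fun v y l => r v (extV v y) (extL v l),
    fun v y l => hr.mem _ _ _, fun v y a => .of_discrete⟩, funext fun x => ?_⟩
  refine (integral_pi_weightMeasure hw _).trans ?_
  refine Fintype.sum_of_injective (fun l ℓ => Fin.castLE (hk ℓ) (l ℓ))
    (fun l l' h => funext fun ℓ => Fin.castLE_injective (hk ℓ) (congrFun h ℓ)) _ _ ?_ ?_
  · intro l hl
    obtain ⟨ℓ, hℓ⟩ : ∃ ℓ, l ℓ ∉ Set.range (Fin.castLE (hk ℓ)) := by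
      by_contra! h
      choose l' hl' using h
      exact hl ⟨l', funext hl'⟩
    rw [Finset.prod_eq_zero (Finset.mem_univ ℓ) (hout ℓ _ hℓ), zero_mul]
  · intro l
    rw [smul_eq_mul]
    congr 1
    refine Finset.prod_congr rfl fun v _ => ?_
    change r v (extV v fun u => x u) (extL v fun ℓ => l ℓ) (x v) = _
    have hvis : r v (extV v fun u => x u) = r v x := hr.vis v fun u hu => by simp [extV, hu]
    rw [hvis]
    exact congrFun (hr.lat v x fun ℓ hℓ => by simp [extL, hℓ]) _

end Main

end LatentCausal

theorem mainTheorem5 {V L : Type*} [Fintype V] [Fintype L]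
    (G : LatentCausal.CausalStructure V L) (hG : G.IsExoSimplicial)
    (Ω : V → Type*) [∀ v, Fintype (Ω v)]
    (Λ : L → Type*) [∀ ℓ, MeasurableSpace (Λ ℓ)]
    (M : LatentCausal.CausalModel G Ω Λ) :
    ∃ (k : L → ℕ) (M' : LatentCausal.CausalModel G Ω (fun ℓ => Fin (k ℓ))),
      M'.observed = M.observed ∧
      ∀ ξ : L, (k ξ : ℤ) ≤ max 1
        ((LatentCausal.affineDimension (LatentCausal.condDistributions Ω
            (G.district ξ) (G.districtParents ξ)) : ℤ) -
          LatentCausal.affineDimension (LatentCausal.condDistributions Ω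
            (G.districtNonDesc ξ) (G.districtParents ξ))) := by
  classical
  let z : ∀ v, Ω v := fun v => (M.nonempty_visible v).some
  -- One common index size, large enough for Carathéodory and for all the bounds at once.
  let N := Fintype.card (∀ v, Ω v) + 1 + ∑ ξ, LatentCausal.outcomeBound G Ω ξ
  have hN : ∀ ξ, LatentCausal.outcomeBound G Ω ξ ≤ N := fun ξ =>
    (Finset.single_le_sum (fun _ _ => Nat.zero_le _) (Finset.mem_univ ξ)).trans
      (Nat.le_add_left _ _)
  obtain ⟨p, r, hp, hr, hM⟩ := M.exists_visibleDist_eq (N := N) (Nat.le_add_right _ _)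
  obtain ⟨p', hp', hk, r', hr', h⟩ := LatentCausal.exists_reduce_latents hp hr z hN
  obtain ⟨M', hM'⟩ := LatentCausal.exists_causalModel hp' hr' z hN hk
  refine ⟨_, M', hM'.trans (h.trans hM), fun ξ => ?_⟩
  -- Truncated and integer subtraction agree under `max 1`.
  rw [LatentCausal.outcomeBound]
  omega
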